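/- All graphs are finite and simple. For a graph $G$, a weight assignment is a function $w:V(G)\to[0,\infty)$ that is not identically $0$; let $\alpha_w(G)=\max\{\sum_{y\in Y}w(y) : Y\subseteq V(G)\text{ independent in }G\}$. The fractional chromatic number $\chi_f(G)$ is the supremum of $\frac{\sum_{v\in V(G)}w(v)}{\alpha_w(G)}$ over all weight assignments $w$ for $G$. A shallow minor of $G$ at depth $r$ is any graph that can be obtained from $G$ by deleting vertices and edges and contracting pairwise vertex-disjoint subgraphs, each of radius at most $r$. (For the graph with no vertices, the average degree and $\chi_f$ are $0$.) A class $\mathcal C$ of graphs has bounded expansion if there exists a function $f_1:\mathbb N\to\mathbb R$ such that for every $r\in\mathbb N$, every shallow minor at depth $r$ of a graph in $\mathcal C$ has average degree at most $f_1(r)$. Corollary. A class $\mathcal C$ of graphs has bounded expansion if and only if there exists a function $f_5:\mathbb N\to\mathbb N$ such that for every $r\in\mathbb N$ and every shallow minor $G$ at depth $r$ of a graph in $\mathcal C$ we have $\chi_f(G)\le f_5(r)$. -/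

import Mathlib

universe u

namespace ShallowMinors

/-- The average degree of a finite graph (equal to `0` for the graph with no vertices). -/
noncomputable def averageDegree {V : Type u} [Fintype V] (G : SimpleGraph V) : ℝ :=
  open Classical in (∑ v, (G.degree v : ℝ)) / (Fintype.card V : ℝ)

/-- A weight assignment: a nonnegative real function on the vertices, not identically `0`. -/
def IsWeightAssignment {V : Type u} (w : V → ℝ) : Prop :=
  (∀ v, 0 ≤ w v) ∧ ∃ v, w v ≠ 0

/-- The finite set of all independent sets of a finite graph. -/
noncomputable def indepSets {V : Type u} [Fintype V] (G : SimpleGraph V) : Finset (Finset V) :=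
  open Classical in Finset.univ.filter fun Y => G.IsIndepSet (Y : Set V)

theorem mem_indepSets {V : Type u} [Fintype V] {G : SimpleGraph V} {Y : Finset V} :
    Y ∈ indepSets G ↔ G.IsIndepSet (Y : Set V) := by
  simp [indepSets]

theorem indepSets_nonempty {V : Type u} [Fintype V] (G : SimpleGraph V) :
    (indepSets G).Nonempty :=
  ⟨∅, by simp [mem_indepSets]⟩

/-- The maximum weight of an independent set of `G`. -/
noncomputable def maxIndepWeight {V : Type u} [Fintype V] (G : SimpleGraph V) (w : V → ℝ) : ℝ :=
  (indepSets G).sup' (indepSets_nonempty G) fun Y => ∑ y ∈ Y, w y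

/-- The set of all ratios of the total weight to the maximum weight of an independent set. -/
def weightRatios {V : Type u} [Fintype V] (G : SimpleGraph V) : Set ℝ :=
  {x | ∃ w : V → ℝ, IsWeightAssignment w ∧ x = (∑ v, w v) / maxIndepWeight G w}

/-- The fractional chromatic number: the supremum of `w(V(G)) / α_w(G)` over all weight
assignments `w` (equal to `0` for the graph with no vertices). The supremum is over a bounded
set, see `bddAbove_weightRatios`. -/
noncomputable def fractionalChromaticNumber {V : Type u} [Fintype V] (G : SimpleGraph V) : ℝ :=
  sSup (weightRatios G)

theorem le_maxIndepWeight {V : Type u} [Fintype V] (G : SimpleGraph V) (w : V → ℝ) (v : V) :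
    w v ≤ maxIndepWeight G w := by
  have h : ({v} : Finset V) ∈ indepSets G := by simp [mem_indepSets]
  have h' : ∑ y ∈ ({v} : Finset V), w y ≤ maxIndepWeight G w :=
    Finset.le_sup' (fun Y : Finset V => ∑ y ∈ Y, w y) h
  rwa [Finset.sum_singleton] at h'

theorem bddAbove_weightRatios {V : Type u} [Fintype V] (G : SimpleGraph V) :
    BddAbove (weightRatios G) := by
  refine ⟨Fintype.card V, ?_⟩
  rintro x ⟨w, ⟨hw, v, hv⟩, rfl⟩
  have hpos : 0 < maxIndepWeight G w :=
    lt_of_lt_of_le (lt_of_le_of_ne (hw v) hv.symm) (le_maxIndepWeight G w v)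
  rw [div_le_iff₀ hpos]
  calc ∑ v, w v ≤ ∑ _v : V, maxIndepWeight G w :=
        Finset.sum_le_sum fun v _ => le_maxIndepWeight G w v
    _ = Fintype.card V * maxIndepWeight G w := by simp

/-- `H` is a shallow minor of `G` at depth `r`: the vertices of `H` are obtained by contracting
pairwise vertex-disjoint subgraphs of `G` of radius at most `r`, the vertices of `G` outside these
subgraphs being deleted, and every edge of `H` comes from an edge of `G` between the two
corresponding subgraphs (the other edges being deleted). The radius of a graph is the `ℕ∞`-valued
one, infinite for empty and for disconnected graphs, and is measured inside the subgraph. -/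
def IsShallowMinor {V W : Type u} (r : ℕ) (H : SimpleGraph W) (G : SimpleGraph V) : Prop :=
  ∃ B : W → G.Subgraph,
    (∀ x, (B x).coe.radius ≤ (r : ℕ∞)) ∧
    (∀ x y, x ≠ y → Disjoint (B x).verts (B y).verts) ∧
    (∀ x y, H.Adj x y → ∃ a ∈ (B x).verts, ∃ b ∈ (B y).verts, G.Adj a b)

/-- A finite simple graph. -/
structure FiniteGraph where
  /-- The vertex set. -/
  V : Type u
  [fintypeV : Fintype V]
  /-- The graph on this vertex set. -/
  graph : SimpleGraph V

attribute [instance] FiniteGraph.fintypeV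

/-- The class of all shallow minors at depth `r` of graphs of the class `C`. -/
def shallowMinors (C : Set FiniteGraph.{u}) (r : ℕ) : Set FiniteGraph.{u} :=
  {H | ∃ G ∈ C, IsShallowMinor r H.graph G.graph}

/-- The class `C` has bounded expansion. -/
def HasBoundedExpansion (C : Set FiniteGraph.{u}) : Prop :=
  ∃ f : ℕ → ℝ, ∀ r : ℕ, ∀ H ∈ shallowMinors C r, averageDegree H.graph ≤ f r

end ShallowMinors

/-!
If every subgraph of `G` has average degree at most `d`, then `G` is `⌊d⌋`-degenerate, so greedy
colouring gives `χ_f(G) ≤ ⌊d⌋ + 1`.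

Conversely, a graph that is not degenerate has a subgraph `F` of large minimum degree. In a random
colouring of the vertices of `F` with a fixed number of colours, almost all vertices have many
neighbours in almost all colour classes, so a small colour class `T` and a much larger set `A`
disjoint from it exist such that every `a ∈ A` has a large set `N(a)` of neighbours in `T`.
Contracting each `a ∈ A` into the first of two random elements of `N(a)` gives a depth `1` minor on
`T` in which each of these pairs is an edge. An independent set contains none of the pairs, which is
so unlikely for sets taking up on average at least `1 / c` of the `N(a)` that, by a union bound over
the `2 ^ |T|` subsets of `T`, some choice of the pairs excludes all of them. Weighting `T` by
`∑ 1 / |N(a)|` then certifies `χ_f > c`. Bounding `χ_f` on shallow minors at depth `1` therefore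
bounds the degeneracy, and shallow minors at depth `1` of those at depth `r` are shallow minors at
depth `3 r + 1`.
-/

namespace ShallowMinors

open Finset

section Radius

variable {V V' : Type*} {G : SimpleGraph V} {G' : SimpleGraph V'}

theorem radius_le_natCast_iff {r : ℕ} :
    G.radius ≤ r ↔ ∃ c, ∀ v, G.edist c v ≤ r := by
  simp only [← SimpleGraph.eccent_le_iff]
  refine ⟨fun h => ?_, fun ⟨c, hc⟩ => SimpleGraph.radius_le_eccent.trans hc⟩
  have : Nonempty V := by
    by_contra! hV
    simp only [SimpleGraph.radius_eq_top_of_isEmpty, top_le_iff, ENat.natCast_ne_top] at h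
  obtain ⟨c, hc⟩ := G.exists_eccent_eq_radius
  exact ⟨c, hc.trans_le h⟩

theorem edist_map_le_mul {f : V → V'} {k : ℕ∞}
    (hf : ∀ x y, G.Adj x y → G'.edist (f x) (f y) ≤ k) {n : ℕ} {x y : V}
    (hxy : G.edist x y ≤ n) : G'.edist (f x) (f y) ≤ n * k := by
  obtain ⟨p, hp⟩ := SimpleGraph.exists_walk_of_edist_ne_top
    (ne_top_of_le_ne_top (ENat.natCast_ne_top n) hxy)
  have hwalk : ∀ {a b} (q : G.Walk a b), G'.edist (f a) (f b) ≤ q.length * k := by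
    intro a b q
    induction q with
    | nil => simp only [SimpleGraph.edist_self, zero_le]
    | @cons a b c hab q ih =>
      calc G'.edist (f a) (f c) ≤ G'.edist (f a) (f b) + G'.edist (f b) (f c) :=
            SimpleGraph.edist_triangle
        _ ≤ k + q.length * k := add_le_add (hf a b hab) ih
        _ = (q.cons hab).length * k := by
          rw [SimpleGraph.Walk.length_cons, Nat.cast_add, Nat.cast_one, add_mul, one_mul, add_comm]
  calc G'.edist (f x) (f y) ≤ p.length * k := hwalk p
    _ ≤ n * k := by rw [hp]; gcongr

theorem edist_map_le (φ : G →g G') {n : ℕ} {x y : V} (hxy : G.edist x y ≤ n) :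
    G'.edist (φ x) (φ y) ≤ n := by
  simpa only [mul_one] using edist_map_le_mul (k := 1)
    (fun _ _ h => (SimpleGraph.edist_eq_one_iff_adj.2 (φ.map_adj h)).le) hxy

/-- Walking along an edge between two branch sets costs `r + 1 + r`: to the endpoint inside the
first one, across, and to the centre of the second one. -/
theorem radius_coe_induce_iUnion_verts_le {r s : ℕ} {D : V → G'.Subgraph}
    (hD : ∀ z, (D z).coe.radius ≤ r)
    (hedge : ∀ x y, G.Adj x y → ∃ a ∈ (D x).verts, ∃ b ∈ (D y).verts, G'.Adj a b)
    {B : G.Subgraph} (hB : B.coe.radius ≤ s) :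
    ((⊤ : G'.Subgraph).induce (⋃ z ∈ B.verts, (D z).verts)).coe.radius ≤
      (s * (2 * r + 1) + r : ℕ) := by
  set U := (⊤ : G'.Subgraph).induce (⋃ z ∈ B.verts, (D z).verts)
  have hle (z : B.verts) : D z ≤ U := SimpleGraph.Subgraph.le_induce_top_verts.trans
    (SimpleGraph.Subgraph.induce_mono_right
      (Set.subset_biUnion_of_mem (u := fun z => (D z).verts) z.2))
  choose d hd using fun z => radius_le_natCast_iff.1 (hD z)
  let center (z : B.verts) : U.verts := SimpleGraph.Subgraph.inclusion (hle z) (d z)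
  have hcenter (z : B.verts) (v : V') (hv : v ∈ (D z).verts) :
      U.coe.edist (center z) ⟨v, (hle z).1 hv⟩ ≤ r :=
    edist_map_le (SimpleGraph.Subgraph.inclusion (hle z)) (hd z ⟨v, hv⟩)
  have hadj (x y : B.verts) (hxy : B.coe.Adj x y) :
      U.coe.edist (center x) (center y) ≤ r + (1 + r) := by
    obtain ⟨a, ha, b, hb, hab⟩ := hedge x y hxy.adj_sub
    have hab' : U.coe.Adj ⟨a, (hle x).1 ha⟩ ⟨b, (hle y).1 hb⟩ :=
      ⟨(hle x).1 ha, (hle y).1 hb, hab⟩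
    refine SimpleGraph.edist_triangle.trans (add_le_add (hcenter x a ha) ?_)
    refine SimpleGraph.edist_triangle.trans
      (add_le_add (SimpleGraph.edist_eq_one_iff_adj.2 hab').le ?_)
    rw [SimpleGraph.edist_comm]
    exact hcenter y b hb
  obtain ⟨c, hc⟩ := radius_le_natCast_iff.1 hB
  refine radius_le_natCast_iff.2 ⟨center c, fun ⟨v, hv⟩ => ?_⟩
  obtain ⟨z, hz, hvz⟩ := Set.mem_iUnion₂.1 hv
  calc U.coe.edist (center c) ⟨v, hv⟩
      ≤ U.coe.edist (center c) (center ⟨z, hz⟩) + U.coe.edist (center ⟨z, hz⟩) ⟨v, hv⟩ :=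
        SimpleGraph.edist_triangle
    _ ≤ s * (r + (1 + r)) + r :=
        add_le_add (edist_map_le_mul hadj (hc ⟨z, hz⟩)) (hcenter ⟨z, hz⟩ v hvz)
    _ = (s * (2 * r + 1) + r : ℕ) := by push_cast; ring

end Radius

section ShallowMinor

variable {U V W : Type u} {r s : ℕ}

theorem IsShallowMinor.trans {F : SimpleGraph U} {G : SimpleGraph V} {H : SimpleGraph W}
    (hHG : IsShallowMinor s H G) (hGF : IsShallowMinor r G F) :
    IsShallowMinor (s * (2 * r + 1) + r) H F := by
  obtain ⟨B, hB, hBdisj, hBedge⟩ := hHG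
  obtain ⟨D, hD, hDdisj, hDedge⟩ := hGF
  refine ⟨fun x => (⊤ : F.Subgraph).induce (⋃ z ∈ (B x).verts, (D z).verts),
    fun x => radius_coe_induce_iUnion_verts_le hD hDedge (hB x), fun x y hxy => ?_,
    fun x y hxy => ?_⟩
  · simp only [SimpleGraph.Subgraph.induce_verts, Set.disjoint_iUnion_left,
      Set.disjoint_iUnion_right]
    exact fun z hz z' hz' => hDdisj z' z ((hBdisj x y hxy).ne_of_mem hz' hz)
  · obtain ⟨z, hz, z', hz', hzz'⟩ := hBedge x y hxy
    obtain ⟨a, ha, b, hb, hab⟩ := hDedge z z' hzz'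
    exact ⟨a, Set.mem_biUnion hz ha, b, Set.mem_biUnion hz' hb, hab⟩

theorem isShallowMinor_zero_induce (G : SimpleGraph V) (S : Set V) :
    IsShallowMinor 0 (G.induce S) G := by
  refine ⟨fun x => G.singletonSubgraph x, fun x => ?_, fun x y hxy => ?_, fun x y hxy => ?_⟩
  · exact (SimpleGraph.radius_eq_zero_iff.2 ⟨⟨⟨x, rfl⟩⟩, Set.subsingleton_singleton.coe_sort⟩).le
  · exact Set.disjoint_singleton.2 (Subtype.coe_ne_coe.2 hxy)
  · exact ⟨x, rfl, y, rfl, hxy⟩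

end ShallowMinor

section FractionalChromaticNumber

variable {V : Type u} [Fintype V] {G : SimpleGraph V}

theorem maxIndepWeight_pos {w : V → ℝ} (hw : IsWeightAssignment w) : 0 < maxIndepWeight G w :=
  let ⟨hnonneg, v, hv⟩ := hw
  ((hnonneg v).lt_of_ne' hv).trans_le (le_maxIndepWeight G w v)

theorem sum_le_maxIndepWeight (w : V → ℝ) {Y : Finset V} (hY : G.IsIndepSet (Y : Set V)) :
    ∑ y ∈ Y, w y ≤ maxIndepWeight G w :=
  le_sup' (fun Y : Finset V => ∑ y ∈ Y, w y) (mem_indepSets.2 hY)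

theorem fractionalChromaticNumber_le_of_colorable {k : ℕ} (h : G.Colorable k) :
    fractionalChromaticNumber G ≤ k := by
  obtain ⟨C⟩ := h
  refine Real.sSup_le ?_ (Nat.cast_nonneg k)
  rintro x ⟨w, hw, rfl⟩
  rw [div_le_iff₀ (maxIndepWeight_pos hw)]
  have hclass (i : Fin k) : G.IsIndepSet (({v | C v = i} : Finset V) : Set V) := by
    rw [coe_filter_univ]
    exact C.isIndepSet_colorClass i
  calc ∑ v, w v = ∑ i : Fin k, ∑ v with C v = i, w v := (sum_fiberwise _ _ _).symm
    _ ≤ ∑ _i : Fin k, maxIndepWeight G w := sum_le_sum fun i _ => sum_le_maxIndepWeight w (hclass i)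
    _ = k * maxIndepWeight G w := by rw [sum_const, card_univ, Fintype.card_fin, nsmul_eq_mul]

theorem lt_fractionalChromaticNumber {c : ℝ} {w : V → ℝ} (hw : ∀ v, 0 ≤ w v)
    (h : ∀ Y : Finset V, G.IsIndepSet (Y : Set V) → c * ∑ y ∈ Y, w y < ∑ v, w v) :
    c < fractionalChromaticNumber G := by
  have hsum : 0 < ∑ v, w v := by
    simpa only [sum_empty, mul_zero] using h ∅ (by rw [coe_empty]; exact Set.pairwise_empty _)
  obtain ⟨v, -, hv⟩ := exists_ne_zero_of_sum_ne_zero hsum.ne'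
  obtain ⟨Y, hY, hYw⟩ := exists_mem_eq_sup' (indepSets_nonempty G) fun Y => ∑ y ∈ Y, w y
  calc c < (∑ v, w v) / maxIndepWeight G w := by
        rw [lt_div_iff₀ (maxIndepWeight_pos ⟨hw, v, hv⟩), maxIndepWeight, hYw]
        exact h Y (mem_indepSets.1 hY)
    _ ≤ fractionalChromaticNumber G :=
        le_csSup (bddAbove_weightRatios G) ⟨w, ⟨hw, v, hv⟩, rfl⟩

end FractionalChromaticNumber

section Degenerate

variable {V : Type u} {G : SimpleGraph V} [DecidableRel G.Adj] {k : ℕ}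

/-- A graph is `k`-degenerate if every nonempty finite set `S` of vertices contains a vertex with
at most `k` neighbours in `S`. Both the average degree and the chromatic number are bounded in terms
of `k`. -/
def IsDegenerate (G : SimpleGraph V) [DecidableRel G.Adj] (k : ℕ) : Prop :=
  ∀ S : Finset V, S.Nonempty → ∃ v ∈ S, #{u ∈ S | G.Adj v u} ≤ k

theorem IsDegenerate.induction_on [DecidableEq V] (h : IsDegenerate G k) {P : Finset V → Prop}
    (empty : P ∅)
    (insert : ∀ S v, v ∉ S → #{u ∈ S | G.Adj v u} ≤ k → P S → P (insert v S)) (S : Finset V) :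
    P S := by
  induction S using Finset.strongInduction with
  | H S ih =>
    rcases S.eq_empty_or_nonempty with rfl | hS
    · exact empty
    obtain ⟨v, hv, hdeg⟩ := h S hS
    rw [← insert_erase hv]
    refine insert _ v (notMem_erase v S) (le_trans ?_ hdeg) (ih _ (erase_ssubset hv))
    exact card_le_card (filter_subset_filter _ (erase_subset v S))

theorem exists_coloringOn_insert [DecidableEq V] {α : Type*} [Fintype α] {S : Finset V} {v : V}
    (hv : v ∉ S) (hdeg : #{u ∈ S | G.Adj v u} < Fintype.card α) {c : V → α}
    (hc : ∀ x ∈ S, ∀ y ∈ S, G.Adj x y → c x ≠ c y) :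
    ∃ c' : V → α, ∀ x ∈ insert v S, ∀ y ∈ insert v S, G.Adj x y → c' x ≠ c' y := by
  classical
  obtain ⟨i, hi⟩ : ∃ i, i ∉ image c {u ∈ S | G.Adj v u} := by
    refine (exists_mem_notMem_of_card_lt_card (t := univ) ?_).imp fun i => And.right
    exact card_image_le.trans_lt hdeg
  have hfree (u : V) (hu : u ∈ S) (huv : G.Adj v u) : c u ≠ i := fun h =>
    hi (mem_image.2 ⟨u, mem_filter.2 ⟨hu, huv⟩, h⟩)
  have hne {u : V} (hu : u ∈ S) : u ≠ v := ne_of_mem_of_not_mem hu hv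
  refine ⟨Function.update c v i, fun x hx y hy hxy => ?_⟩
  rcases mem_insert.1 hx with rfl | hxS <;> rcases mem_insert.1 hy with rfl | hyS
  · exact absurd hxy (G.irrefl)
  · rw [Function.update_self, Function.update_of_ne (hne hyS)]
    exact (hfree y hyS hxy).symm
  · rw [Function.update_self, Function.update_of_ne (hne hxS)]
    exact hfree x hxS hxy.symm
  · rw [Function.update_of_ne (hne hxS), Function.update_of_ne (hne hyS)]
    exact hc x hxS y hyS hxy

theorem IsDegenerate.colorable [Finite V] (h : IsDegenerate G k) : G.Colorable (k + 1) := by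
  classical
  have := Fintype.ofFinite V
  obtain ⟨c, hc⟩ : ∃ c : V → Fin (k + 1), ∀ x ∈ univ, ∀ y ∈ univ, G.Adj x y → c x ≠ c y :=
    h.induction_on
      (P := fun S => ∃ c : V → Fin (k + 1), ∀ x ∈ S, ∀ y ∈ S, G.Adj x y → c x ≠ c y)
      ⟨fun _ => 0, fun x hx => absurd hx (notMem_empty x)⟩
      (fun S v hv hdeg ⟨c, hc⟩ =>
        exists_coloringOn_insert hv (by rwa [Fintype.card_fin, Nat.lt_succ_iff]) hc) univ
  exact ⟨.mk c fun {x y} hxy => hc x (mem_univ x) y (mem_univ y) hxy⟩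

theorem sum_card_adj_insert [DecidableEq V] {S : Finset V} {v : V} (hv : v ∉ S) :
    ∑ x ∈ insert v S, #{u ∈ insert v S | G.Adj x u} =
      ∑ x ∈ S, #{u ∈ S | G.Adj x u} + 2 * #{u ∈ S | G.Adj v u} := by
  have hcard (x : V) : #{u ∈ insert v S | G.Adj x u} =
      #{u ∈ S | G.Adj x u} + if G.Adj v x then 1 else 0 := by
    rw [card_filter, sum_insert hv, ← card_filter, add_comm]
    simp only [G.adj_comm x v]
  simp only [sum_insert hv, hcard, G.irrefl, if_false, sum_add_distrib, ← card_filter]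
  ring

theorem averageDegree_eq [Fintype V] (G : SimpleGraph V) [DecidableRel G.Adj] :
    averageDegree G = (∑ v, (G.degree v : ℝ)) / Fintype.card V := by
  unfold averageDegree
  congr!

theorem IsDegenerate.averageDegree_le [Fintype V] (h : IsDegenerate G k) :
    averageDegree G ≤ 2 * k := by
  classical
  have hsum : ∑ v, #{u ∈ univ | G.Adj v u} ≤ 2 * k * #(univ : Finset V) := by
    refine h.induction_on (P := fun S => ∑ v ∈ S, #{u ∈ S | G.Adj v u} ≤ 2 * k * #S) ?_ ?_ univ
    · rw [sum_empty]
      exact Nat.zero_le _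
    · intro S v hv hdeg ih
      rw [sum_card_adj_insert hv, card_insert_of_notMem hv]
      linarith
  rw [averageDegree_eq]
  refine div_le_of_le_mul₀ (Nat.cast_nonneg _) (by positivity) ?_
  simp only [← SimpleGraph.neighborFinset_eq_filter, SimpleGraph.card_neighborFinset_eq_degree,
    card_univ] at hsum
  exact_mod_cast hsum

theorem degree_induce (S : Finset V) (v : (S : Set V)) :
    (G.induce (S : Set V)).degree v = #{u ∈ S | G.Adj v u} := by
  rw [← SimpleGraph.card_neighborFinset_eq_degree, ← card_map (.subtype (· ∈ (S : Set V)))]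
  congr 1
  ext u
  simp [and_comm]

theorem exists_degree_le_averageDegree [Fintype V] [Nonempty V] (G : SimpleGraph V)
    [DecidableRel G.Adj] : ∃ v, (G.degree v : ℝ) ≤ averageDegree G := by
  obtain ⟨v, -, hv⟩ := exists_le_of_sum_le (f := fun v => (G.degree v : ℝ))
    (g := fun _ => averageDegree G) univ_nonempty <| by
      rw [sum_const, card_univ, nsmul_eq_mul, averageDegree_eq,
        mul_div_cancel₀ _ (Nat.cast_ne_zero.2 Fintype.card_ne_zero)]
  exact ⟨v, hv⟩

theorem isDegenerate_of_averageDegree_induce_le {d : ℝ}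
    (h : ∀ S : Finset V, averageDegree (G.induce (S : Set V)) ≤ d) : IsDegenerate G ⌊d⌋₊ := by
  classical
  intro S hS
  have : Nonempty (S : Set V) := hS.to_subtype
  obtain ⟨v, hv⟩ := exists_degree_le_averageDegree (G.induce (S : Set V))
  refine ⟨v, v.2, Nat.le_floor ?_⟩
  rw [← degree_induce]
  exact hv.trans (h S)

end Degenerate

section RandomColoring

variable {α β ι : Type*} [Fintype ι] [DecidableEq ι]

/-- The colours of the points are independent and uniform, so the sum factors over the points. -/
theorem sum_pow_card_fiber [Fintype β] [DecidableEq β] {R : Type*} [CommRing R] (N : Finset β)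
    (i : ι) (x : R) :
    ∑ f : β → ι, x ^ #{u ∈ N | f u = i} =
      (Fintype.card ι - 1 + x) ^ #N * Fintype.card ι ^ #Nᶜ := by
  let factor (u : β) (j : ι) : R := if u ∈ N then if j = i then x else 1 else 1
  have hfactor (f : β → ι) : x ^ #{u ∈ N | f u = i} = ∏ u, factor u (f u) := by
    rw [prod_ite_mem, univ_inter, ← prod_filter, prod_const]
  have hsum (u : β) :
      ∑ j, factor u j = if u ∈ N then (Fintype.card ι - 1 + x : R) else Fintype.card ι := by
    by_cases hu : u ∈ N
    · simp only [factor, hu, if_true]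
      rw [sum_ite, sum_const, sum_const, filter_eq' univ i, if_pos (mem_univ i), card_singleton,
        filter_ne' univ i, one_smul, nsmul_one, cast_card_erase_of_mem (mem_univ i), card_univ,
        add_comm]
    · simp [factor, hu]
  simp only [hfactor]
  rw [← Fintype.piFinset_univ, ← prod_univ_sum]
  simp only [hsum]
  rw [prod_ite, prod_const, prod_const, filter_mem_eq_inter, univ_inter, filter_notMem_eq_sdiff,
    compl_eq_univ_sdiff]

/-- Markov's inequality for `2 ^ (-#{u ∈ N | f u = i})`. -/
theorem card_fiber_lt_le [Fintype β] [DecidableEq β] (N : Finset β) (i : ι) (d : ℕ) :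
    (#{f : β → ι | #{u ∈ N | f u = i} < d} : ℝ) ≤
      2 ^ d * (1 - 1 / (2 * Fintype.card ι)) ^ #N * Fintype.card ι ^ Fintype.card β := by
  have : Nonempty ι := ⟨i⟩
  have hι : (Fintype.card ι : ℝ) ≠ 0 := Nat.cast_ne_zero.2 Fintype.card_ne_zero
  calc (#{f : β → ι | #{u ∈ N | f u = i} < d} : ℝ)
      = ∑ f : β → ι with #{u ∈ N | f u = i} < d, 1 := by simp
    _ ≤ ∑ f : β → ι with #{u ∈ N | f u = i} < d, 2 ^ d * (1 / 2) ^ #{u ∈ N | f u = i} := by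
      refine sum_le_sum fun f hf => ?_
      rw [one_div, inv_pow, ← div_eq_mul_inv, one_le_div (by positivity)]
      exact pow_le_pow_right₀ one_le_two (mem_filter.1 hf).2.le
    _ ≤ ∑ f : β → ι, 2 ^ d * (1 / 2) ^ #{u ∈ N | f u = i} :=
      sum_le_sum_of_subset_of_nonneg (filter_subset _ _) fun f _ _ => by positivity
    _ = 2 ^ d * ((Fintype.card ι * (1 - 1 / (2 * Fintype.card ι))) ^ #N *
          Fintype.card ι ^ #Nᶜ) := by
      rw [← mul_sum, sum_pow_card_fiber]
      congr 3
      field_simp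
      ring
    _ = 2 ^ d * (1 - 1 / (2 * Fintype.card ι)) ^ #N * Fintype.card ι ^ Fintype.card β := by
      rw [← card_add_card_compl N, mul_pow, pow_add]
      ring

variable [Fintype α] [Nonempty α]

theorem exists_coloring_sum_card_fiber_lt [Finite β] [Nonempty ι] {d : ℕ} {N : α → Finset β}
    (hN : ∀ a, 2 ^ d * (1 - 1 / (2 * Fintype.card ι) : ℝ) ^ #(N a) < 1 / 2) :
    ∃ f : β → ι, 2 * ∑ i, #{a | #{u ∈ N a | f u = i} < d} < Fintype.card ι * Fintype.card α := by
  classical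
  have := Fintype.ofFinite β
  have hfew (i : ι) (a : α) :
      (2 * #{f : β → ι | #{u ∈ N a | f u = i} < d} : ℝ) < Fintype.card ι ^ Fintype.card β := by
    have hpos : (0 : ℝ) < Fintype.card ι ^ Fintype.card β := by positivity
    linarith [card_fiber_lt_le (N a) i d, mul_lt_mul_of_pos_right (hN a) hpos]
  have hswap : ∑ f : β → ι, 2 * ∑ i, #{a | #{u ∈ N a | f u = i} < d} =
      ∑ i : ι, ∑ a, 2 * #{f : β → ι | #{u ∈ N a | f u = i} < d} := by
    simp only [← mul_sum, card_filter]
    rw [sum_comm]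
    exact congrArg _ (sum_congr rfl fun i _ => sum_comm)
  have hlt : ∑ f : β → ι, 2 * ∑ i, #{a | #{u ∈ N a | f u = i} < d} <
      ∑ _f : β → ι, Fintype.card ι * Fintype.card α :=
    calc _ < ∑ _i : ι, ∑ _a : α, Fintype.card ι ^ Fintype.card β := by
          rw [hswap]
          exact sum_lt_sum_of_nonempty univ_nonempty fun i _ =>
            sum_lt_sum_of_nonempty univ_nonempty fun a _ => by exact_mod_cast hfew i a
      _ = _ := by
          simp only [sum_const, card_univ, smul_eq_mul, Fintype.card_fun]
          ring
  exact (exists_lt_of_sum_lt hlt).imp fun f => And.right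

theorem exists_mul_card_lt_card_inter [Fintype β] [DecidableEq β] {R d : ℕ} (hR : 0 < R)
    {N : α → Finset β}
    (hN : ∀ a, 2 ^ d * (1 - 1 / (4 * R) : ℝ) ^ #(N a) < 1 / 2)
    (hcard : Fintype.card β ≤ Fintype.card α) :
    ∃ T : Finset β, R * #T < #{a | d ≤ #(N a ∩ T)} := by
  have : NeZero (2 * R) := ⟨by omega⟩
  obtain ⟨f, hf⟩ := exists_coloring_sum_card_fiber_lt (ι := Fin (2 * R)) (N := N) (d := d)
    fun a => by convert hN a using 5; push_cast [Fintype.card_fin]; ring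
  rw [Fintype.card_fin] at hf
  have hcompl (i : Fin (2 * R)) : #{a | #{u ∈ N a | f u = i} < d} +
      #{a | d ≤ #{u ∈ N a | f u = i}} = Fintype.card α := by
    simpa only [not_lt, card_univ] using
      card_filter_add_card_filter_not (s := univ) fun a => #{u ∈ N a | f u = i} < d
  have htotal := sum_congr (rfl : univ = univ) fun i _ => hcompl i
  rw [sum_add_distrib, sum_const, card_univ, Fintype.card_fin, smul_eq_mul] at htotal
  have hclasses : ∑ i, #{u | f u = i} = Fintype.card β :=
    (card_eq_sum_card_fiberwise fun _ _ => mem_coe.2 (mem_univ _)).symm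
  have hsum : ∑ i, R * #{u | f u = i} < ∑ i, #{a | d ≤ #{u ∈ N a | f u = i}} := by
    rw [← mul_sum, hclasses]
    nlinarith
  obtain ⟨i, -, hi⟩ := exists_lt_of_sum_lt hsum
  refine ⟨({u | f u = i} : Finset β), hi.trans_eq ?_⟩
  simp only [inter_filter, inter_univ]

end RandomColoring

theorem exists_disjoint_forall_le_card_neighborFinset_inter (R d : ℕ) :
    ∃ M : ℕ, ∀ {V : Type u} [Fintype V] [DecidableEq V] [Nonempty V] (G : SimpleGraph V)
      [DecidableRel G.Adj], (∀ v, M ≤ G.degree v) →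
      ∃ A T : Finset V, Disjoint A T ∧ R * #T < #A ∧
        ∀ a ∈ A, d ≤ #(G.neighborFinset a ∩ T) := by
  have hpos : (0 : ℝ) < 1 / (4 * (R + 1 : ℕ)) := by positivity
  have hle : (1 : ℝ) / (4 * (R + 1 : ℕ)) ≤ 1 := by
    rw [div_le_one (by positivity)]
    push_cast
    linarith [Nat.cast_nonneg (α := ℝ) R]
  obtain ⟨M, hM⟩ := exists_pow_lt_of_lt_one (x := 1 / 2 / (2 : ℝ) ^ d) (by positivity)
    (sub_lt_self 1 hpos)
  refine ⟨M, fun {V} _ _ _ G _ hG => ?_⟩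
  obtain ⟨T, hT⟩ := exists_mul_card_lt_card_inter (d := d) R.succ_pos
    (N := fun v => G.neighborFinset v)
    (fun v => by
      rw [← lt_div_iff₀' (by positivity), G.card_neighborFinset_eq_degree]
      exact (pow_le_pow_of_le_one (sub_nonneg.2 hle) (sub_lt_self 1 hpos).le (hG v)).trans_lt hM)
    le_rfl
  refine ⟨({v | d ≤ #(G.neighborFinset v ∩ T)} : Finset V) \ T, T, sdiff_disjoint, ?_, ?_⟩
  · have := le_card_sdiff T {v | d ≤ #(G.neighborFinset v ∩ T)}
    rw [Nat.succ_mul] at hT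
    omega
  · intro a ha
    exact (mem_filter.1 (mem_sdiff.1 ha).1).2

section RandomPairs

variable {α β : Type*}

theorem card_mul_exp_neg_card_lt_one [Fintype β] [Nonempty β] (s : Finset (Finset β)) :
    #s * Real.exp (-Fintype.card β) < 1 := by
  have he : 2 ^ Fintype.card β < Real.exp 1 ^ Fintype.card β :=
    pow_lt_pow_left₀ (by linarith [Real.exp_one_gt_d9]) zero_le_two Fintype.card_ne_zero
  calc #s * Real.exp (-Fintype.card β)
      ≤ 2 ^ Fintype.card β * Real.exp (-Fintype.card β) := by
        gcongr
        exact_mod_cast (card_le_univ s).trans_eq Fintype.card_finset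
    _ < Real.exp 1 ^ Fintype.card β * Real.exp (-Fintype.card β) :=
        mul_lt_mul_of_pos_right he (Real.exp_pos _)
    _ = 1 := by rw [Real.exp_one_pow, ← Real.exp_add, add_neg_cancel, Real.exp_zero]

theorem exists_forall_mem_forall_exists_notMem [Fintype α] {κ : Type*} (bad : Finset κ)
    (s : α → Finset β) (t : κ → α → Finset β) (h : ∑ Y ∈ bad, ∏ a, #(t Y a) < ∏ a, #(s a)) :
    ∃ g : α → β, (∀ a, g a ∈ s a) ∧ ∀ Y ∈ bad, ∃ a, g a ∉ t Y a := by
  classical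
  have hcard : #(bad.biUnion fun Y => Fintype.piFinset (t Y)) < #(Fintype.piFinset s) := by
    refine card_biUnion_le.trans_lt ?_
    simpa only [Fintype.card_piFinset] using h
  obtain ⟨g, hgs, hgt⟩ := exists_mem_notMem_of_card_lt_card hcard
  refine ⟨g, Fintype.mem_piFinset.1 hgs, fun Y hY => ?_⟩
  by_contra! hg
  exact hgt (mem_biUnion.2 ⟨Y, hY, Fintype.mem_piFinset.2 hg⟩)

variable [DecidableEq β]

/-- The proportion of the elements of `N` that belong to `Y`, with value `0` if `N` is empty. It
measures how likely a random pair from `N` is to lie inside `Y`, and its values on singletons are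
the vertex weights. -/
noncomputable def relDensity (N Y : Finset β) : ℝ :=
  #(N ∩ Y) / #N

theorem relDensity_nonneg (N Y : Finset β) : 0 ≤ relDensity N Y := by
  unfold relDensity
  positivity

theorem relDensity_univ [Fintype β] {N : Finset β} (hN : N.Nonempty) :
    relDensity N univ = 1 := by
  rw [relDensity, inter_univ, div_self (Nat.cast_ne_zero.2 hN.card_ne_zero)]

theorem sum_relDensity_singleton (N Y : Finset β) :
    ∑ y ∈ Y, relDensity N {y} = relDensity N Y := by
  have hcard : ∑ y ∈ Y, #(N ∩ {y}) = #(N ∩ Y) := by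
    simp only [inter_comm N, singleton_inter, apply_ite card, card_singleton, card_empty,
      ← card_filter, filter_mem_eq_inter]
  simp only [relDensity, ← sum_div, ← Nat.cast_sum, hcard]

theorem card_product_self_sdiff_offDiag_le (N Y : Finset β) :
    (#(N ×ˢ N \ Y.offDiag) : ℝ) ≤
      (#N : ℝ) ^ 2 * Real.exp (-(relDensity N Y ^ 2 - relDensity N Y / #N)) := by
  rcases N.eq_empty_or_nonempty with rfl | hN
  · simp
  have hN' : (#N : ℝ) ≠ 0 := Nat.cast_ne_zero.2 hN.card_ne_zero
  have hinter : Y.offDiag ∩ N ×ˢ N = (N ∩ Y).offDiag := by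
    ext ⟨a, b⟩
    simp only [mem_inter, mem_product, mem_offDiag]
    tauto
  have hcard : (#(N ×ˢ N \ Y.offDiag) : ℝ) = (#N : ℝ) ^ 2 - ((#(N ∩ Y) : ℝ) ^ 2 - #(N ∩ Y)) := by
    rw [card_sdiff, hinter, offDiag_card, card_product,
      Nat.cast_sub (Nat.sub_le_of_le_add ?_), Nat.cast_sub (Nat.le_mul_self _)]
    · push_cast
      ring
    · exact (Nat.mul_le_mul (card_le_card inter_subset_left)
        (card_le_card inter_subset_left)).trans (Nat.le_add_right _ _)
  calc (#(N ×ˢ N \ Y.offDiag) : ℝ)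
      = (#N : ℝ) ^ 2 * (-(relDensity N Y ^ 2 - relDensity N Y / #N) + 1) := by
        rw [hcard, relDensity]
        field_simp
        ring
    _ ≤ _ := by
        gcongr
        exact Real.add_one_le_exp _

/-- Tangent line to `q ↦ q ^ 2` at `1 / c`. -/
theorem mul_sub_le_sq_sub_div {c q n : ℝ} (hc : 0 < c) (hq : 0 ≤ q) (hn : 2 * c ≤ n) :
    3 / (2 * c) * q - 1 / c ^ 2 ≤ q ^ 2 - q / n := by
  have htangent : q ^ 2 - (2 / c * q - 1 / c ^ 2) = (q - 1 / c) ^ 2 := by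
    field_simp
    ring
  have hdiv : q / n ≤ q / (2 * c) := by gcongr
  have hsplit : 2 / c * q - q / (2 * c) = 3 / (2 * c) * q := by
    field_simp
    ring
  linarith [sq_nonneg (q - 1 / c)]

variable [Fintype α]

theorem prod_card_product_self_sdiff_offDiag_le {c : ℝ} (hc : 0 < c) {N : α → Finset β}
    (hN : ∀ a, 2 * c ≤ #(N a)) {Y : Finset β}
    (hY : Fintype.card α / c ≤ ∑ a, relDensity (N a) Y) :
    (∏ a, #(N a ×ˢ N a \ Y.offDiag) : ℝ) ≤
      (∏ a, (#(N a) : ℝ) ^ 2) * Real.exp (-(Fintype.card α / (2 * c ^ 2))) := by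
  have hsum : Fintype.card α / (2 * c ^ 2) ≤
      ∑ a, (relDensity (N a) Y ^ 2 - relDensity (N a) Y / #(N a)) :=
    calc Fintype.card α / (2 * c ^ 2)
        = 3 / (2 * c) * (Fintype.card α / c) - Fintype.card α * (1 / c ^ 2) := by
          field_simp
          ring
      _ ≤ 3 / (2 * c) * ∑ a, relDensity (N a) Y - Fintype.card α * (1 / c ^ 2) := by gcongr
      _ = ∑ a, (3 / (2 * c) * relDensity (N a) Y - 1 / c ^ 2) := by
          rw [sum_sub_distrib, mul_sum, sum_const, card_univ, nsmul_eq_mul]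
      _ ≤ _ := sum_le_sum fun a _ => mul_sub_le_sq_sub_div hc (relDensity_nonneg _ _) (hN a)
  calc (∏ a, #(N a ×ˢ N a \ Y.offDiag) : ℝ)
      ≤ ∏ a, (#(N a) : ℝ) ^ 2 *
          Real.exp (-(relDensity (N a) Y ^ 2 - relDensity (N a) Y / #(N a))) :=
        prod_le_prod (fun a _ => Nat.cast_nonneg _) fun a _ =>
          card_product_self_sdiff_offDiag_le (N a) Y
    _ = (∏ a, (#(N a) : ℝ) ^ 2) *
          Real.exp (-∑ a, (relDensity (N a) Y ^ 2 - relDensity (N a) Y / #(N a))) := by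
        rw [prod_mul_distrib, ← Real.exp_sum, sum_neg_distrib]
    _ ≤ _ := by gcongr

theorem exists_pairs_forall_sum_relDensity_lt [Fintype β] [Nonempty α] {c : ℝ} (hc : 0 < c)
    {N : α → Finset β} (hN : ∀ a, 2 * c ≤ #(N a))
    (hcard : 2 * c ^ 2 * Fintype.card β ≤ Fintype.card α) :
    ∃ g : α → β × β, (∀ a, g a ∈ N a ×ˢ N a) ∧ ∀ Y : Finset β, (∀ a, g a ∉ Y.offDiag) →
      ∑ a, relDensity (N a) Y < Fintype.card α / c := by
  classical
  have hNpos (a : α) : 0 < #(N a) := by exact_mod_cast (by linarith [hN a] : (0 : ℝ) < #(N a))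
  have hβ : Nonempty β := ⟨(card_pos.1 (hNpos (Classical.arbitrary α))).choose⟩
  let bad : Finset (Finset β) := {Y | Fintype.card α / c ≤ ∑ a, relDensity (N a) Y}
  have hprod : 0 < ∏ a, (#(N a) : ℝ) ^ 2 := prod_pos fun a _ => by
    have := hNpos a
    positivity
  have hunion : (∑ Y ∈ bad, ∏ a, #(N a ×ˢ N a \ Y.offDiag) : ℝ) < ∏ a, #(N a ×ˢ N a) :=
    calc (∑ Y ∈ bad, ∏ a, #(N a ×ˢ N a \ Y.offDiag) : ℝ)
        ≤ ∑ _Y ∈ bad, (∏ a, (#(N a) : ℝ) ^ 2) * Real.exp (-(Fintype.card β)) := by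
          refine sum_le_sum fun Y hY =>
            (prod_card_product_self_sdiff_offDiag_le hc hN (mem_filter.1 hY).2).trans ?_
          gcongr
          rwa [le_div_iff₀' (by positivity)]
      _ = (∏ a, (#(N a) : ℝ) ^ 2) * (#bad * Real.exp (-(Fintype.card β))) := by
          rw [sum_const, nsmul_eq_mul]
          ring
      _ < ∏ a, (#(N a) : ℝ) ^ 2 := mul_lt_of_lt_one_right hprod (card_mul_exp_neg_card_lt_one bad)
      _ = ∏ a, #(N a ×ˢ N a) := by simp only [card_product, sq, Nat.cast_prod, Nat.cast_mul]
  obtain ⟨g, hgN, hg⟩ := exists_forall_mem_forall_exists_notMem bad (fun a => N a ×ˢ N a)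
    (fun Y a => N a ×ˢ N a \ Y.offDiag) (by exact_mod_cast hunion)
  refine ⟨g, hgN, fun Y hY => ?_⟩
  by_contra! hle
  obtain ⟨a, ha⟩ := hg Y (mem_filter.2 ⟨mem_univ Y, hle⟩)
  exact ha (mem_sdiff.2 ⟨hgN a, hY a⟩)

end RandomPairs

section PairGraph

variable {α : Type*}

/-- The graph whose edges are the chosen pairs `g a`, pairs of equal vertices being ignored. It is
the shallow minor whose fractional chromatic number is large. -/
def pairGraph {W : Type*} (g : α → W × W) : SimpleGraph W :=
  .fromRel fun x y => ∃ a, g a = (x, y)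

theorem notMem_offDiag_of_isIndepSet_pairGraph {W : Type*} {g : α → W × W}
    {Y : Finset W} (hY : (pairGraph g).IsIndepSet (Y : Set W)) (a : α) : g a ∉ Y.offDiag := by
  intro ha
  obtain ⟨h₁, h₂, hne⟩ := mem_offDiag.1 ha
  exact hY h₁ h₂ hne ⟨hne, .inl ⟨a, rfl⟩⟩

/-- Contracting each edge from `ψ a` to the first vertex of the pair `g a` turns the path through
`ψ a` into an edge joining the pair. -/
theorem isShallowMinor_one_pairGraph {V W : Type u} {G : SimpleGraph V} (φ : W ↪ V) (ψ : α ↪ V)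
    (hdisj : ∀ x a, φ x ≠ ψ a) {g : α → W × W} (hfst : ∀ a, G.Adj (ψ a) (φ (g a).1))
    (hsnd : ∀ a, G.Adj (ψ a) (φ (g a).2)) : IsShallowMinor 1 (pairGraph g) G := by
  let star (x : W) : Set V := insert (φ x) (ψ '' {a | (g a).1 = x})
  have hcenter (x : W) : φ x ∈ star x := Set.mem_insert _ _
  have hleaf (a : α) : ψ a ∈ star (g a).1 := .inr ⟨a, rfl, rfl⟩
  refine ⟨fun x => (⊤ : G.Subgraph).induce (star x), fun x => ?_, fun x y hxy => ?_, ?_⟩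
  · refine radius_le_natCast_iff.2 ⟨⟨φ x, hcenter x⟩, fun ⟨v, hv⟩ => ?_⟩
    rw [Nat.cast_one, SimpleGraph.edist_le_one_iff_adj_or_eq]
    obtain rfl | ⟨a, rfl, rfl⟩ := hv
    · exact .inr rfl
    · exact .inl ⟨hcenter _, hleaf a, (hfst a).symm⟩
  · refine Set.disjoint_left.2 ?_
    rintro v (rfl | ⟨a, rfl, rfl⟩) (h | ⟨b, rfl, h⟩)
    · exact hxy (φ.injective h)
    · exact hdisj x b h.symm
    · exact hdisj y a h.symm
    · exact hxy (by rw [ψ.injective h])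
  · rintro x y ⟨-, ⟨a, ha⟩ | ⟨a, ha⟩⟩
    · have hx : ψ a ∈ star x := by simpa only [ha] using hleaf a
      have hy : G.Adj (ψ a) (φ y) := by simpa only [ha] using hsnd a
      exact ⟨ψ a, hx, φ y, hcenter y, hy⟩
    · have hy : ψ a ∈ star y := by simpa only [ha] using hleaf a
      have hx : G.Adj (ψ a) (φ x) := by simpa only [ha] using hsnd a
      exact ⟨φ x, hcenter x, ψ a, hy, hx.symm⟩

/-- The weight of a vertex `y` is the sum of `1 / #(N a)` over the sets `N a` containing `y`, so
that the total weight is the number of sets. -/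
theorem lt_fractionalChromaticNumber_pairGraph {W : Type u} [Fintype W] [DecidableEq W]
    [Fintype α] {c : ℝ} (hc : 0 < c) {N : α → Finset W} (hN : ∀ a, (N a).Nonempty)
    {g : α → W × W} (hg : ∀ Y : Finset W, (∀ a, g a ∉ Y.offDiag) →
      ∑ a, relDensity (N a) Y < Fintype.card α / c) :
    c < fractionalChromaticNumber (pairGraph g) := by
  have hweight (Y : Finset W) :
      ∑ y ∈ Y, ∑ a, relDensity (N a) {y} = ∑ a, relDensity (N a) Y := by
    rw [sum_comm]
    exact sum_congr rfl fun a _ => sum_relDensity_singleton (N a) Y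
  refine lt_fractionalChromaticNumber (w := fun y => ∑ a, relDensity (N a) {y})
    (fun y => sum_nonneg fun a _ => relDensity_nonneg _ _) fun Y hY => ?_
  rw [hweight, hweight, sum_congr rfl fun a _ => relDensity_univ (hN a), sum_const, card_univ,
    nsmul_one, ← lt_div_iff₀' hc]
  exact hg Y (notMem_offDiag_of_isIndepSet_pairGraph hY)

end PairGraph

section LargeDegree

variable {V : Type u} [Fintype V] {G : SimpleGraph V} [DecidableRel G.Adj]

theorem exists_isShallowMinor_one_lt_fractionalChromaticNumber [DecidableEq V] {c : ℝ} (hc : 0 < c)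
    {A T : Finset V} (hA : A.Nonempty) (hAT : Disjoint A T) (hcard : 2 * c ^ 2 * #T ≤ #A)
    (hdeg : ∀ a ∈ A, 2 * c ≤ #(G.neighborFinset a ∩ T)) :
    ∃ H : SimpleGraph T, IsShallowMinor 1 H G ∧ c < fractionalChromaticNumber H := by
  let N (a : A) : Finset T := (G.neighborFinset a).subtype (· ∈ T)
  have hN (a : A) : 2 * c ≤ #(N a) := by
    rw [card_subtype, filter_mem_eq_inter]
    exact hdeg a a.2
  have hNne (a : A) : (N a).Nonempty :=
    card_pos.1 (by exact_mod_cast (by linarith [hN a] : (0 : ℝ) < #(N a)))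
  have hadj {a : A} {x : T} (hx : x ∈ N a) : G.Adj a x := by
    simpa only [N, mem_subtype, SimpleGraph.mem_neighborFinset] using hx
  have : Nonempty A := hA.to_subtype
  obtain ⟨g, hgN, hg⟩ := exists_pairs_forall_sum_relDensity_lt hc hN
    (by simpa only [Fintype.card_coe] using hcard)
  refine ⟨pairGraph g, ?_, lt_fractionalChromaticNumber_pairGraph hc hNne hg⟩
  exact isShallowMinor_one_pairGraph (.subtype (· ∈ T)) (.subtype (· ∈ A))
    (fun x a => (disjoint_iff_ne.1 hAT a a.2 x x.2).symm)
    (fun a => hadj (mem_product.1 (hgN a)).1) (fun a => hadj (mem_product.1 (hgN a)).2)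

theorem exists_isDegenerate_of_fractionalChromaticNumber_le (c : ℝ) :
    ∃ M : ℕ, ∀ {V : Type u} (G : SimpleGraph V) [DecidableRel G.Adj],
      (∀ {W : Type u} [Fintype W] (H : SimpleGraph W), IsShallowMinor 1 H G →
        fractionalChromaticNumber H ≤ c) → IsDegenerate G M := by
  classical
  have hb : 0 < max c 1 := lt_max_of_lt_right one_pos
  obtain ⟨M, hM⟩ := exists_disjoint_forall_le_card_neighborFinset_inter.{u}
    ⌈2 * max c 1 ^ 2⌉₊ ⌈2 * max c 1⌉₊
  refine ⟨M, fun {V} G _ hχ S hS => ?_⟩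
  by_contra! hlarge
  have : Nonempty (S : Set V) := hS.to_subtype
  obtain ⟨A, T, hAT, hcard, hdeg⟩ := hM (G.induce (S : Set V)) fun v => by
    rw [degree_induce]
    exact (hlarge v v.2).le
  obtain ⟨H, hH, hlt⟩ := exists_isShallowMinor_one_lt_fractionalChromaticNumber hb
    (card_pos.1 ((Nat.zero_le _).trans_lt hcard)) hAT
    ((mul_le_mul_of_nonneg_right (Nat.le_ceil _) (Nat.cast_nonneg _)).trans
      (by exact_mod_cast hcard.le))
    fun a ha => Nat.ceil_le.1 (hdeg a ha)
  exact ((le_max_left c 1).trans_lt hlt).not_ge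
    (hχ H (hH.trans (isShallowMinor_zero_induce G S)))

end LargeDegree

section Classes

variable {C : Set FiniteGraph.{u}} {r s : ℕ} {G : FiniteGraph.{u}}

theorem mem_shallowMinors_of_isShallowMinor {W : Type u} [Fintype W] {H : SimpleGraph W}
    (hG : G ∈ shallowMinors C r) (hH : IsShallowMinor s H G.graph) :
    ⟨W, H⟩ ∈ shallowMinors C (s * (2 * r + 1) + r) :=
  let ⟨F, hF, hGF⟩ := hG
  ⟨F, hF, hH.trans hGF⟩

theorem induce_mem_shallowMinors (hG : G ∈ shallowMinors C r) (S : Finset G.V) :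
    ⟨(S : Set G.V), G.graph.induce (S : Set G.V)⟩ ∈ shallowMinors C r := by
  simpa only [zero_mul, zero_add] using
    mem_shallowMinors_of_isShallowMinor hG (isShallowMinor_zero_induce G.graph S)

end Classes

end ShallowMinors

theorem mainTheorem4 (C : Set ShallowMinors.FiniteGraph.{u}) :
    ShallowMinors.HasBoundedExpansion C ↔
      ∃ f : ℕ → ℕ, ∀ r : ℕ, ∀ H ∈ ShallowMinors.shallowMinors C r,
        ShallowMinors.fractionalChromaticNumber H.graph ≤ (f r : ℝ) := by
  classical
  open ShallowMinors in
  constructor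
  · rintro ⟨f, hf⟩
    refine ⟨fun r => ⌊f r⌋₊ + 1, fun r H hH => fractionalChromaticNumber_le_of_colorable ?_⟩
    have hdeg : IsDegenerate H.graph ⌊f r⌋₊ := isDegenerate_of_averageDegree_induce_le fun S =>
      hf r _ (induce_mem_shallowMinors hH S)
    exact hdeg.colorable
  · rintro ⟨f, hf⟩
    choose M hM using exists_isDegenerate_of_fractionalChromaticNumber_le.{u}
    refine ⟨fun r => 2 * M (f (1 * (2 * r + 1) + r)), fun r H hH => ?_⟩
    have hdeg : IsDegenerate H.graph (M (f (1 * (2 * r + 1) + r))) := hM _ H.graph fun F hF =>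
      hf _ _ (mem_shallowMinors_of_isShallowMinor hH hF)
    exact hdeg.averageDegree_le
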